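/- Let $[k]=\{1,\dots,k\}$ and let $\Delta_k$ be the set of probability vectors on $[k]$. A non-interactive protocol for $n$ users over $[k]$ works as follows: a public random seed $R$ is drawn (public-coin; in the private-coin case $R$ is trivial); each user $j$, holding $x_j\in[k]$, sends one message drawn from $Q_{j,R}(\cdot\mid x_j)$, the messages being independent given $R$; and the server, from $R$ and the $n$ messages, outputs a (possibly randomised) vector in $\mathbb R^k$. The protocol is $\varepsilon$-LDP if for every seed and every user, $Q_{j,R}(S\mid x)\le e^{\varepsilon}Q_{j,R}(S\mid x')$ for all $x,x'\in[k]$ and all measurable sets $S$ of messages. For $k,n\ge 1$ and $\varepsilon>0$ put $$\mathcal L(k,n,\varepsilon)=\max\left(\sqrt{\frac{\log k}{n(e^{\varepsilon}-1)^2}},\ \sqrt{\frac{\log k}{n e^{\varepsilon}}},\ \frac{\log k}{n\varepsilon}\right).$$ (1) Distribution estimation. There is an absolute constant $c>0$ such that for all $k,n\ge1$, all $\varepsilon>0$ and every non-interactive (public- or private-coin) $\varepsilon$-LDP protocol with output $\hat p$, $$\sup_{p\in\Delta_k}\ \mathbb E_{X_1,\dots,X_n\sim p\text{ i.i.d.}}\,\|\hat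 p-p\|_\infty\ \ge\ c\,\min\{1,\mathcal L(k,n,\varepsilon)\}.$$ (2) Frequency estimation. There are absolute constants $c,c'>0$ such that for all $k,n\ge1$, all $0<\varepsilon\le\max(1,c'\log k)$ and every non-interactive (public- or private-coin) $\varepsilon$-LDP protocol with output $\hat q$, $$\sup_{x\in[k]^n}\ \mathbb E\,\|\hat q-q(x)\|_\infty\ \ge\ c\,\min\{1,\mathcal L(k,n,\varepsilon)\},$$ where $q(x)_i=\frac1n\#\{j: x_j=i\}$ are the empirical frequencies of the dataset $x$. -/

import Mathlib

open MeasureTheory ProbabilityTheory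

/-- A non-interactive protocol for `n` users whose data lie in the alphabet `Fin k`. A public seed
`r : Seed` is drawn from `seedLaw` and revealed to everybody; user `j`, holding `x j`, then sends one
message drawn from `randomizer j (r, x j)`, independently of the other users given `r`; finally the
server, seeing the seed and all the messages, outputs a (possibly randomised) vector in `ℝ^k`.
These are the public-coin protocols; the private-coin ones are those whose seed is trivial
(`Seed` a one-point type, such as `Unit`). -/
structure NonInteractiveProtocol (Seed Msg : Type*) [MeasurableSpace Seed] [MeasurableSpace Msg]
    (k n : ℕ) where
  seedLaw : Measure Seed
  isProbabilityMeasure_seedLaw : IsProbabilityMeasure seedLaw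
  randomizer : Fin n → Kernel (Seed × Fin k) Msg
  isMarkovKernel_randomizer : ∀ j, IsMarkovKernel (randomizer j)
  server : Kernel (Seed × (Fin n → Msg)) (Fin k → ℝ)
  isMarkovKernel_server : IsMarkovKernel server

namespace NonInteractiveProtocol

variable {Seed Msg : Type*} [MeasurableSpace Seed] [MeasurableSpace Msg] {k n : ℕ}

/-- `ε`-local differential privacy: for every value of the public seed, the randomiser of every user
satisfies `P(Q(x) ∈ S) ≤ e^ε P(Q(x') ∈ S)` for all inputs `x, x'` and all events `S`. -/
def IsLDP (P : NonInteractiveProtocol Seed Msg k n) (ε : ℝ) : Prop :=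
  ∀ (r : Seed) (j : Fin n) (x x' : Fin k) (S : Set Msg), MeasurableSet S →
    P.randomizer j (r, x) S ≤ ENNReal.ofReal (Real.exp ε) * P.randomizer j (r, x') S

/-- The expected `ℓ∞` distance (the norm of `Fin k → ℝ` is the sup norm) between the output of the
protocol on the fixed dataset `x` and the vector `target`; the expectation is over the public seed,
the messages and the randomness of the server. -/
noncomputable def expectedLoss (P : NonInteractiveProtocol Seed Msg k n)
    (x : Fin n → Fin k) (target : Fin k → ℝ) : ENNReal :=
  ∫⁻ r, ∫⁻ y, ∫⁻ v, ENNReal.ofReal ‖v - target‖ ∂(P.server (r, y))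
    ∂(Measure.pi fun j => P.randomizer j (r, x j)) ∂P.seedLaw

/-- The expected `ℓ∞` error in estimating the distribution `p` when the data of the `n` users are
i.i.d. samples from `p`. -/
noncomputable def distributionError (P : NonInteractiveProtocol Seed Msg k n)
    (p : Fin k → ℝ) : ENNReal :=
  ∑ x : Fin n → Fin k, ENNReal.ofReal (∏ j, p (x j)) * P.expectedLoss x p

/-- Worst-case expected `ℓ∞` error for distribution estimation, over all distributions on `Fin k`. -/
noncomputable def worstCaseDistributionError (P : NonInteractiveProtocol Seed Msg k n) : ENNReal :=
  ⨆ p ∈ stdSimplex ℝ (Fin k), P.distributionError p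

/-- The vector of empirical frequencies of a dataset, `q_i = #{j | x j = i} / n`. -/
noncomputable def empiricalFrequency (x : Fin n → Fin k) : Fin k → ℝ :=
  fun i => (∑ j : Fin n, if x j = i then (1 : ℝ) else 0) / n

/-- Worst-case expected `ℓ∞` error for frequency estimation, over all datasets. -/
noncomputable def worstCaseFrequencyError (P : NonInteractiveProtocol Seed Msg k n) : ENNReal :=
  ⨆ x : Fin n → Fin k, P.expectedLoss x (empiricalFrequency x)

end NonInteractiveProtocol

/-- `max (√(log k / (n (e^ε - 1)²)), √(log k / (n e^ε)), log k / (n ε))`. -/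
noncomputable def ldpRate (k n : ℕ) (ε : ℝ) : ℝ :=
  max (max (Real.sqrt (Real.log k / (n * (Real.exp ε - 1) ^ 2)))
      (Real.sqrt (Real.log k / (n * Real.exp ε))))
    (Real.log k / (n * ε))

/-! Fix a base symbol `o`, draw `v` uniformly from all `k` symbols, and let each user independently
hold `v` with probability `α` and `o` otherwise, where `α = min 1 L / 16` and `L` is the rate.
Relative to the randomiser's output on `o`, a message then has density `1 - α + α f`, with `f` of
mean one and values in `[e^(-ε), e^ε]`. Its relative entropy is at most each of `α² (e^ε - 1)²`, `α²
e^ε` and `α ε`. These match the three terms of the rate, so the total over `n` users is at most `log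
k / 16`. A Fano argument (`sum_integral_spikeMixture_le`) then bounds the average probability of
recovering `v` by `7/8`. All this holds for each fixed seed; since `v` is drawn independently of the
seed, the bounds are averaged over it at the end.

An accurate output would reveal `v`: take its largest coordinate away from `o`, or `o` itself if
none exceeds `τ = α / 64`. For distribution estimation the target is `α` at `v ≠ o` and zero at the
other symbols except `o`, so each decoding failure costs at least `τ`.

For frequency estimation the target `q(x)_v` is random and may be correlated with failure. No
concentration is used: by linearity, the mean of `q(x)_v` on the failure event is `(α / n) ∑ j,
P_j(failure)`, where `P_j` is the law with user `j` forced to hold `v`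
(`sum_failureProb_update_le`). For `ε ≤ 1`, privacy makes `P_j(failure)` comparable to `P(failure)`.
For `ε ≤ log k / 16`, forcing one user adds at most `ε` to the entropy, so Fano applies to `P_j`
directly. -/

open scoped ENNReal

/-! ### Densities of private randomisers and one-user entropy bounds -/

section Density

variable {Ω : Type*} [MeasurableSpace Ω]

/-- Two probability measures dominating each other up to the factor `e^ε` have a density with
values in `[e^(-ε), e^ε]`. -/
theorem exists_density_of_le_exp_mul {μ ν : Measure Ω} [IsProbabilityMeasure μ]
    [IsProbabilityMeasure ν] {ε : ℝ}
    (hμν : ∀ S, MeasurableSet S → μ S ≤ ENNReal.ofReal (Real.exp ε) * ν S)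
    (hνμ : ∀ S, MeasurableSet S → ν S ≤ ENNReal.ofReal (Real.exp ε) * μ S) :
    ∃ f : Ω → ℝ, Measurable f ∧ (∀ y, Real.exp (-ε) ≤ f y ∧ f y ≤ Real.exp ε) ∧
      μ = ν.withDensity fun y => ENNReal.ofReal (f y) := by
  have hac : μ ≪ ν := by
    refine Measure.AbsolutelyContinuous.mk fun S hS h => ?_
    simpa [h] using hμν S hS
  have hwd := Measure.withDensity_rnDeriv_eq μ ν hac
  have hm := Measure.measurable_rnDeriv μ ν
  have hset : ∀ S, ∫⁻ y in S, μ.rnDeriv ν y ∂ν = μ S := fun S => by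
    rw [← withDensity_apply' _ S, hwd]
  have hup : μ.rnDeriv ν ≤ᵐ[ν] fun _ => ENNReal.ofReal (Real.exp ε) := by
    refine ae_le_of_forall_setLIntegral_le_of_sigmaFinite hm fun S hS _ => ?_
    rw [hset, setLIntegral_const]
    exact hμν S hS
  have hlo : (fun _ => (1 : ℝ≥0∞)) ≤ᵐ[ν]
      fun y => ENNReal.ofReal (Real.exp ε) * μ.rnDeriv ν y := by
    refine ae_le_of_forall_setLIntegral_le_of_sigmaFinite measurable_const fun S hS _ => ?_
    rw [lintegral_const_mul _ hm, hset, setLIntegral_const, one_mul]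
    exact hνμ S hS
  have hle : Real.exp (-ε) ≤ Real.exp ε := by
    have h := hνμ Set.univ MeasurableSet.univ
    simp only [measure_univ, mul_one] at h
    have h1 : 1 ≤ Real.exp ε := ENNReal.one_le_ofReal.1 h
    rw [Real.one_le_exp_iff] at h1
    exact Real.exp_le_exp.2 (by linarith)
  -- The Radon–Nikodym derivative is clipped so that the bounds hold everywhere; it changes only on
  -- a null set.
  refine ⟨fun y => max (Real.exp (-ε)) (min (Real.exp ε) (μ.rnDeriv ν y).toReal), ?_,
    fun y => ⟨le_max_left _ _, max_le hle (min_le_left _ _)⟩, ?_⟩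
  · exact measurable_const.max (measurable_const.min hm.ennreal_toReal)
  · conv_lhs => rw [← hwd]
    refine withDensity_congr_ae ?_
    filter_upwards [hup, hlo] with y h1 h2
    have hfin : μ.rnDeriv ν y ≠ ∞ := ne_top_of_le_ne_top ENNReal.ofReal_ne_top h1
    have h1' : (μ.rnDeriv ν y).toReal ≤ Real.exp ε :=
      ENNReal.toReal_le_of_le_ofReal (Real.exp_pos _).le h1
    have h2' : Real.exp (-ε) ≤ (μ.rnDeriv ν y).toReal := by
      have := ENNReal.toReal_mono (ENNReal.mul_ne_top ENNReal.ofReal_ne_top hfin) h2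
      rw [ENNReal.toReal_mul, ENNReal.toReal_ofReal (Real.exp_pos _).le, ENNReal.toReal_one] at this
      rw [Real.exp_neg, inv_le_iff_one_le_mul₀' (Real.exp_pos _)]
      exact this
    rw [min_eq_right h1', max_eq_right h2', ENNReal.ofReal_toReal hfin]

theorem integrable_of_measurable_of_mem_Icc {ν : Measure Ω} [IsFiniteMeasure ν] {f : Ω → ℝ}
    (hf : Measurable f) {a b : ℝ} (h : ∀ y, a ≤ f y ∧ f y ≤ b) : Integrable f ν :=
  Integrable.of_mem_Icc a b hf.aemeasurable (.of_forall fun y => ⟨(h y).1, (h y).2⟩)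

/-- Bound on the relative entropy of a mixture with weight `a` of a base law and of a law with
density `f` with values in `[e^(-ε), e^ε]`. -/
theorem integral_mix_mul_log_le {ν : Measure Ω} [IsProbabilityMeasure ν] {f : Ω → ℝ} {a ε : ℝ}
    (hε : 0 ≤ ε) (ha0 : 0 ≤ a) (ha1 : a ≤ 1) (hf : Measurable f)
    (hb : ∀ y, Real.exp (-ε) ≤ f y ∧ f y ≤ Real.exp ε) (hint : ∫ y, f y ∂ν = 1) :
    ∫ y, (1 - a + a * f y) * Real.log (1 - a + a * f y) ∂ν ≤
      min (min (a ^ 2 * (Real.exp ε - 1) ^ 2) (a ^ 2 * Real.exp ε)) (a * ε) := by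
  have hfi : Integrable f ν := integrable_of_measurable_of_mem_Icc hf hb
  have hexp1 : 1 ≤ Real.exp ε := Real.one_le_exp hε
  have hpos : ∀ y, 0 < f y := fun y => (Real.exp_pos _).trans_le (hb y).1
  have hgpos : ∀ y, 0 < 1 - a + a * f y := fun y => by
    rcases ha1.lt_or_eq with h | h
    · have := mul_nonneg ha0 (hpos y).le
      linarith
    · rw [h]; linarith [hpos y]
  have hgi : Integrable (fun y => (1 - a + a * f y) * Real.log (1 - a + a * f y)) ν := by
    have hgle : ∀ y, 1 - a + a * f y ≤ Real.exp ε := fun y => by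
      nlinarith [(hb y).2]
    have hg : Measurable fun y => 1 - a + a * f y := by fun_prop
    refine integrable_of_measurable_of_mem_Icc (a := -1) (b := Real.exp ε * ε)
      (hg.mul hg.log) fun y => ⟨?_, ?_⟩
    · have := Real.one_sub_inv_le_log_of_pos (hgpos y)
      have h2 := mul_le_mul_of_nonneg_left this (hgpos y).le
      rw [mul_sub, mul_inv_cancel₀ (hgpos y).ne'] at h2
      linarith [hgpos y]
    · have hlog : Real.log (1 - a + a * f y) ≤ ε := by
        rw [Real.log_le_iff_le_exp (hgpos y)]; exact hgle y
      exact (mul_le_mul_of_nonneg_left hlog (hgpos y).le).trans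
        (mul_le_mul_of_nonneg_right (hgle y) hε)
  -- Since `f` has mean one, a pointwise bound affine in `f` integrates to the sum of its
  -- coefficients. Each of the three estimates supplies such a bound.
  have key : ∀ c₁ c₀ : ℝ, (∀ y, (1 - a + a * f y) * Real.log (1 - a + a * f y) ≤ c₁ * f y + c₀) →
      ∫ y, (1 - a + a * f y) * Real.log (1 - a + a * f y) ∂ν ≤ c₁ + c₀ := by
    intro c₁ c₀ h
    have hi : Integrable (fun y => c₁ * f y + c₀) ν := (hfi.const_mul _).add (integrable_const _)
    refine (integral_mono hgi hi h).trans_eq ?_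
    rw [integral_add (hfi.const_mul _) (integrable_const _), integral_const_mul, hint]
    simp
  have hquad : ∀ y, (1 - a + a * f y) * Real.log (1 - a + a * f y) ≤
      a * (f y - 1) + a ^ 2 * (f y - 1) ^ 2 := fun y => by
    have := mul_le_mul_of_nonneg_left (Real.log_le_sub_one_of_pos (hgpos y)) (hgpos y).le
    nlinarith
  refine le_min (le_min ?_ ?_) ?_
  · refine (key a (-a + a ^ 2 * (Real.exp ε - 1) ^ 2) fun y => (hquad y).trans ?_).trans_eq (by ring)
    have h1 : (f y - 1) ^ 2 ≤ (Real.exp ε - 1) ^ 2 := by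
      apply sq_le_sq'
      · have h2 := Real.add_one_le_exp ε
        have h3 := Real.add_one_le_exp (-ε)
        linarith [(hb y).1]
      · linarith [(hb y).2]
    nlinarith [mul_le_mul_of_nonneg_left h1 (sq_nonneg a)]
  · refine (key (a + a ^ 2 * (Real.exp ε - 2)) (-a + a ^ 2) fun y => (hquad y).trans ?_).trans ?_
    · have h1 : (f y - 1) ^ 2 ≤ (Real.exp ε - 2) * f y + 1 := by
        nlinarith [(hb y).2, hpos y]
      nlinarith [mul_le_mul_of_nonneg_left h1 (sq_nonneg a)]
    · nlinarith [sq_nonneg a]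
  · refine (key (a * ε) 0 fun y => ?_).trans_eq (by ring)
    -- Convexity of `x log x` between `1` and `f` makes the bound linear in `a`.
    have hc := Real.convexOn_mul_log.2 (x := 1) (y := f y) (by simp) (hpos y).le
      (sub_nonneg.2 ha1) ha0 (by ring)
    simp only [smul_eq_mul, mul_one, Real.log_one, mul_zero, zero_add] at hc
    have hlog : Real.log (f y) ≤ ε := by
      rw [Real.log_le_iff_le_exp (hpos y)]; exact (hb y).2
    have : a * (f y * Real.log (f y)) ≤ a * (f y * ε) := by
      have := (hpos y).le
      gcongr
    linarith

/-- The Fenchel–Young inequality for the pair `x log x - x + 1`, `e^y - 1`, linearised in the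
second variable on `[0, l]`. -/
theorem mul_mul_le_mul_log_add {l t G : ℝ} (ht0 : 0 ≤ t) (ht1 : t ≤ 1) (hG : 0 < G) :
    l * (t * G) ≤ G * Real.log G - G + 1 + (Real.exp l - 1) * t := by
  have h1 : Real.exp (l * t) ≤ 1 + (Real.exp l - 1) * t := by
    have := convexOn_exp.2 (x := 0) (y := l) (by simp) (by simp) (sub_nonneg.2 ht1) ht0 (by ring)
    simp only [smul_eq_mul, mul_zero, zero_add, Real.exp_zero, mul_one] at this
    rw [mul_comm l t]
    linarith
  have h2 : G * (l * t - Real.log G + 1) ≤ Real.exp (l * t) := by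
    have := mul_le_mul_of_nonneg_left (Real.add_one_le_exp (l * t - Real.log G)) hG.le
    rwa [Real.exp_sub, Real.exp_log hG, mul_div_cancel₀ _ hG.ne'] at this
  nlinarith

end Density

/-! ### Change of measure for product laws -/

section Product

variable {Ω ι : Type*} [MeasurableSpace Ω] [Fintype ι]

theorem pi_withDensity_ofReal {ν : ι → Measure Ω} [∀ j, IsProbabilityMeasure (ν j)]
    {g : ι → Ω → ℝ} (hg : ∀ j, Measurable (g j)) (h0 : ∀ j y, 0 ≤ g j y)
    [∀ j, SigmaFinite ((ν j).withDensity fun y => ENNReal.ofReal (g j y))] :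
    Measure.pi (fun j => (ν j).withDensity fun y => ENNReal.ofReal (g j y)) =
      (Measure.pi ν).withDensity fun y => ENNReal.ofReal (∏ j, g j (y j)) := by
  refine Measure.pi_eq fun S hS => ?_
  have hind := iIndepFun_pi (μ := ν)
    (X := fun j => (S j).indicator fun y => ENNReal.ofReal (g j y))
    fun j => ((hg j).ennreal_ofReal.indicator (hS j)).aemeasurable
  have hprod := lintegral_prod_eq_prod_lintegral_of_indepFun Finset.univ _ hind
    fun j => ((hg j).ennreal_ofReal.indicator (hS j)).comp (measurable_pi_apply j)
  rw [withDensity_apply _ (MeasurableSet.univ_pi hS), ← lintegral_indicator (MeasurableSet.univ_pi hS)]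
  simp only [withDensity_apply _ (hS _)]
  have hev : ∀ j, ∫⁻ y in S j, ENNReal.ofReal (g j y) ∂(ν j) =
      ∫⁻ y, (S j).indicator (fun y => ENNReal.ofReal (g j y)) (y j) ∂(Measure.pi ν) := fun j => by
    rw [← lintegral_indicator (hS j),
      ← (measurePreserving_eval ν j).lintegral_comp ((hg j).ennreal_ofReal.indicator (hS j))]
  simp only [hev, ← hprod]
  refine lintegral_congr fun y => ?_
  by_cases hy : y ∈ Set.univ.pi S
  · rw [Set.indicator_of_mem hy, ENNReal.ofReal_prod_of_nonneg fun j _ => h0 j _]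
    exact Finset.prod_congr rfl fun j _ =>
      (Set.indicator_of_mem (f := fun y => ENNReal.ofReal (g j y)) (hy j trivial)).symm
  · rw [Set.indicator_of_notMem hy]
    simp only [Set.mem_univ_pi, not_forall] at hy
    obtain ⟨j, hj⟩ := hy
    exact (Finset.prod_eq_zero (Finset.mem_univ j) (Set.indicator_of_notMem hj _)).symm

/-- Relative entropy bound for the change of a product measure: an event (or a test `φ`) that is
likely under the product of the `g j • ν j` and unlikely under the product of the `ν j` forces a
large total relative entropy. -/
theorem mul_integral_pi_withDensity_le {ν : ι → Measure Ω} [∀ j, IsProbabilityMeasure (ν j)]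
    {g : ι → Ω → ℝ} (hg : ∀ j, Measurable (g j)) {c C : ℝ} (hc : 0 < c)
    (hb : ∀ j y, c ≤ g j y ∧ g j y ≤ C) (hint : ∀ j, ∫ y, g j y ∂(ν j) = 1)
    [∀ j, SigmaFinite ((ν j).withDensity fun y => ENNReal.ofReal (g j y))]
    {φ : (ι → Ω) → ℝ} (hφ : Measurable φ) (h0 : ∀ y, 0 ≤ φ y) (h1 : ∀ y, φ y ≤ 1) (l : ℝ) :
    l * ∫ y, φ y ∂(Measure.pi fun j => (ν j).withDensity fun y => ENNReal.ofReal (g j y)) ≤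
      ∑ j, ∫ y, g j y * Real.log (g j y) ∂(ν j) +
        (Real.exp l - 1) * ∫ y, φ y ∂(Measure.pi ν) := by
  classical
  have hpos : ∀ j y, 0 < g j y := fun j y => hc.trans_le (hb j y).1
  have hgi : ∀ j, Integrable (g j) (ν j) := fun j =>
    integrable_of_measurable_of_mem_Icc (hg j) (hb j)
  have hGm : Measurable fun y : ι → Ω => ∏ j, g j (y j) := by fun_prop
  have hGpos : ∀ y : ι → Ω, 0 < ∏ j, g j (y j) := fun y => Finset.prod_pos fun j _ => hpos j _
  rw [pi_withDensity_ofReal hg fun j y => (hpos j y).le,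
    integral_withDensity_eq_integral_toReal_smul hGm.ennreal_ofReal (by simp)]
  simp only [ENNReal.toReal_ofReal (hGpos _).le, smul_eq_mul]
  have hGi : Integrable (fun y : ι → Ω => ∏ j, g j (y j)) (Measure.pi ν) :=
    Integrable.fintype_prod_dep hgi
  have hGint : ∫ y : ι → Ω, ∏ j, g j (y j) ∂(Measure.pi ν) = 1 := by
    rw [integral_fintype_prod_eq_prod]; simp [hint]
  have hφi : Integrable φ (Measure.pi ν) :=
    integrable_of_measurable_of_mem_Icc hφ fun y => ⟨h0 y, h1 y⟩
  have hGφi : Integrable (fun y : ι → Ω => (∏ j, g j (y j)) * φ y) (Measure.pi ν) :=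
    hGi.mul_bdd (c := 1) hφ.aestronglyMeasurable
      (.of_forall fun y => by rw [Real.norm_of_nonneg (h0 y)]; exact h1 y)
  have hli : ∀ j, Integrable (fun y => g j y * Real.log (g j y)) (ν j) := fun j => by
    refine (hgi j).mul_bdd (c := max |Real.log c| |Real.log C|) (hg j).log.aestronglyMeasurable
      (.of_forall fun y => ?_)
    rw [Real.norm_eq_abs]
    exact abs_le_max_abs_abs (Real.log_le_log hc (hb j y).1)
      (Real.log_le_log (hpos j y) (hb j y).2)
  -- Additivity of entropy: this term is still a product over coordinates, with factor `j` replaced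
  -- by `g log g`. The other factors integrate to one.
  have hterm : ∀ (j : ι) (y : ι → Ω), (∏ i, g i (y i)) * Real.log (g j (y j)) =
      ∏ i, (if i = j then fun z => g i z * Real.log (g i z) else g i) (y i) := fun j y => by
    rw [← Finset.mul_prod_erase _ _ (Finset.mem_univ j), mul_right_comm]
    conv_rhs => rw [← Finset.mul_prod_erase _ _ (Finset.mem_univ j), if_pos rfl]
    congr 1
    refine Finset.prod_congr rfl fun i hi => ?_
    rw [if_neg (Finset.ne_of_mem_erase hi)]
  have hti : ∀ j, Integrable (fun y : ι → Ω => (∏ i, g i (y i)) * Real.log (g j (y j)))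
      (Measure.pi ν) := fun j => by
    simp only [hterm]
    refine Integrable.fintype_prod_dep fun i => ?_
    split_ifs
    exacts [hli i, hgi i]
  have hte : ∀ j, ∫ y : ι → Ω, (∏ i, g i (y i)) * Real.log (g j (y j)) ∂(Measure.pi ν) =
      ∫ y, g j y * Real.log (g j y) ∂(ν j) := fun j => by
    simp only [hterm]
    rw [integral_fintype_prod_eq_prod, Finset.prod_eq_single j]
    · rw [if_pos rfl]
    · intro i _ hij
      rw [if_neg hij, hint]
    · simp
  have hlog : ∀ y : ι → Ω, (∏ i, g i (y i)) * Real.log (∏ i, g i (y i)) =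
      ∑ j, (∏ i, g i (y i)) * Real.log (g j (y j)) := fun y => by
    rw [Real.log_prod fun i _ => (hpos i _).ne', Finset.mul_sum]
  rw [← integral_const_mul]
  have hsum : Integrable (fun y : ι → Ω => ∑ j, (∏ i, g i (y i)) * Real.log (g j (y j)))
      (Measure.pi ν) := integrable_finsetSum _ fun j _ => hti j
  calc ∫ y, l * ((∏ j, g j (y j)) * φ y) ∂(Measure.pi ν)
      ≤ ∫ y, ((∑ j, (∏ i, g i (y i)) * Real.log (g j (y j))) - (∏ j, g j (y j)) + 1 +
          (Real.exp l - 1) * φ y) ∂(Measure.pi ν) := by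
        refine integral_mono (hGφi.const_mul _)
          (((hsum.sub hGi).add (integrable_const _)).add (hφi.const_mul _)) fun y => ?_
        have := mul_mul_le_mul_log_add (l := l) (h0 y) (h1 y) (hGpos y)
        simp only [← hlog]
        linarith
    _ = _ := by
        have e1 := integral_add ((hsum.sub hGi).add (integrable_const (1 : ℝ)))
          (hφi.const_mul (Real.exp l - 1))
        have e2 := integral_add (hsum.sub hGi) (integrable_const (1 : ℝ))
        simp only [Pi.add_apply, Pi.sub_apply] at e1 e2
        rw [e1, e2, integral_sub hsum hGi, hGint, integral_finsetSum _ fun j _ => hti j,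
          integral_const_mul]
        simp [hte]

end Product

/-! ### Spike mixtures and their weights -/

/-- Upper bound on the relative entropy, with respect to the output of an `ε`-LDP randomiser on a
base symbol, of its output when the base symbol is replaced with probability `a`. -/
noncomputable def klBound (ε a : ℝ) : ℝ :=
  min (min (a ^ 2 * (Real.exp ε - 1) ^ 2) (a ^ 2 * Real.exp ε)) (a * ε)

/-- The weights of the mixture `(1 - a) δ_o + a δ_v`. -/
noncomputable def spikeWeight {k : ℕ} (o v : Fin k) (a : ℝ) (x : Fin k) : ℝ :=
  (1 - a) * (if x = o then 1 else 0) + a * (if x = v then 1 else 0)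

/-- The law of the messages when user `j` independently holds `v` with probability `a j` and `o`
otherwise. -/
noncomputable def spikeMixture {Msg : Type*} [MeasurableSpace Msg] {k n : ℕ}
    (q : Fin n → Fin k → Measure Msg) (o v : Fin k) (a : Fin n → ℝ) : Measure (Fin n → Msg) :=
  Measure.pi fun j => ENNReal.ofReal (1 - a j) • q j o + ENNReal.ofReal (a j) • q j v

section Weights

variable {k : ℕ} {o v : Fin k} {a : ℝ}

theorem spikeWeight_nonneg (h0 : 0 ≤ a) (h1 : a ≤ 1) (x : Fin k) : 0 ≤ spikeWeight o v a x := by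
  have := sub_nonneg.2 h1
  unfold spikeWeight
  positivity

theorem sum_spikeWeight : ∑ x, spikeWeight o v a x = 1 := by
  simp [spikeWeight, Finset.sum_add_distrib]

theorem spikeWeight_mem_stdSimplex (h0 : 0 ≤ a) (h1 : a ≤ 1) :
    spikeWeight o v a ∈ stdSimplex ℝ (Fin k) :=
  ⟨spikeWeight_nonneg h0 h1, sum_spikeWeight⟩

theorem ofReal_spikeWeight (h0 : 0 ≤ a) (h1 : a ≤ 1) (x : Fin k) :
    ENNReal.ofReal (spikeWeight o v a x) =
      ENNReal.ofReal (1 - a) * (if x = o then 1 else 0) +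
        ENNReal.ofReal a * (if x = v then 1 else 0) := by
  have := sub_nonneg.2 h1
  rw [spikeWeight, ENNReal.ofReal_add (by positivity) (by positivity),
    ENNReal.ofReal_mul this, ENNReal.ofReal_mul h0]
  congr 2 <;> split_ifs <;> simp

theorem sum_ofReal_spikeWeight_smul {M : Type*} [AddCommMonoid M] [Module ℝ≥0∞ M]
    (h0 : 0 ≤ a) (h1 : a ≤ 1) (μ : Fin k → M) :
    ∑ x, ENNReal.ofReal (spikeWeight o v a x) • μ x =
      ENNReal.ofReal (1 - a) • μ o + ENNReal.ofReal a • μ v := by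
  simp only [ofReal_spikeWeight h0 h1, add_smul, mul_smul, ite_smul, one_smul, zero_smul, smul_ite,
    smul_zero, Finset.sum_add_distrib, Finset.sum_ite_eq', Finset.mem_univ, if_true]

end Weights

/-- A product of finite mixtures is a mixture of products. -/
theorem pi_sum_smul {ι X Ω : Type*} [Fintype ι] [DecidableEq ι] [Fintype X] [MeasurableSpace Ω]
    (q : ι → X → Measure Ω) [∀ j x, SigmaFinite (q j x)] (w : ι → X → ℝ≥0∞)
    [∀ j, SigmaFinite (∑ x, w j x • q j x)] :
    Measure.pi (fun j => ∑ x, w j x • q j x) =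
      ∑ x : ι → X, (∏ j, w j (x j)) • Measure.pi fun j => q j (x j) := by
  refine Measure.pi_eq fun S hS => ?_
  simp only [Measure.coe_finsetSum, Finset.sum_apply, Measure.smul_apply, smul_eq_mul,
    Measure.pi_pi]
  rw [Finset.prod_univ_sum, Fintype.piFinset_univ]
  simp only [Finset.prod_mul_distrib]

/-- `1 - 1 / k ≤ (3 / 4) log k` for integers `k ≥ 2`. -/
theorem natCast_sub_one_le_mul_log {k : ℕ} (hk : 2 ≤ k) :
    (k : ℝ) - 1 ≤ 3 / 4 * (k * Real.log k) := by
  have h2 := Real.log_two_gt_d9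
  have hk' : (2 : ℝ) ≤ k := by exact_mod_cast hk
  -- Write `k = 2 · (k / 2)`: the estimate is exact at `k = 2`, the tightest case for the constant
  -- `3 / 4`.
  have hlog : Real.log 2 + (1 - 2 / k) ≤ Real.log k := by
    have := Real.one_sub_inv_le_log_of_pos (x := (k : ℝ) / 2) (by positivity)
    rw [Real.log_div (by positivity) (by norm_num), inv_div] at this
    linarith
  have hmul : (k : ℝ) * (Real.log 2 + (1 - 2 / k)) ≤ k * Real.log k := by gcongr
  have : (k : ℝ) * (Real.log 2 + (1 - 2 / k)) = k * Real.log 2 + k - 2 := by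
    field_simp; ring
  nlinarith

/-! ### Fano's bound for a fixed seed -/

section FixedSeed

variable {Msg : Type*} [MeasurableSpace Msg] {k n : ℕ} {q : Fin n → Fin k → Measure Msg}
  [∀ j x, IsProbabilityMeasure (q j x)] {ε : ℝ}

theorem isProbabilityMeasure_ofReal_smul_add {Ω : Type*} [MeasurableSpace Ω] (μ ν : Measure Ω)
    [IsProbabilityMeasure μ] [IsProbabilityMeasure ν] {a : ℝ} (h0 : 0 ≤ a) (h1 : a ≤ 1) :
    IsProbabilityMeasure (ENNReal.ofReal (1 - a) • μ + ENNReal.ofReal a • ν) := by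
  constructor
  simp only [Measure.add_apply, Measure.smul_apply, measure_univ, smul_eq_mul, mul_one]
  rw [← ENNReal.ofReal_add (sub_nonneg.2 h1) h0]
  simp

theorem isProbabilityMeasure_spikeMixture (o v : Fin k) {a : Fin n → ℝ}
    (ha : ∀ j, 0 ≤ a j ∧ a j ≤ 1) : IsProbabilityMeasure (spikeMixture q o v a) := by
  have := fun j => isProbabilityMeasure_ofReal_smul_add (q j o) (q j v) (ha j).1 (ha j).2
  unfold spikeMixture
  infer_instance

/-- This links the two readings of the prior: a product of per-user mixtures, where entropies add
up, and a law on datasets, where losses are defined. -/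
theorem spikeMixture_eq_sum (o v : Fin k) {a : Fin n → ℝ} (ha : ∀ j, 0 ≤ a j ∧ a j ≤ 1) :
    spikeMixture q o v a = ∑ x : Fin n → Fin k,
      (∏ j, ENNReal.ofReal (spikeWeight o v (a j) (x j))) • Measure.pi fun j => q j (x j) := by
  have h := fun j => isProbabilityMeasure_ofReal_smul_add (q j o) (q j v) (ha j).1 (ha j).2
  have e : ∀ j, ∑ x, ENNReal.ofReal (spikeWeight o v (a j) x) • q j x =
      ENNReal.ofReal (1 - a j) • q j o + ENNReal.ofReal (a j) • q j v :=
    fun j => sum_ofReal_spikeWeight_smul (ha j).1 (ha j).2 _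
  have : ∀ j, SigmaFinite (∑ x, ENNReal.ofReal (spikeWeight o v (a j) x) • q j x) := fun j => by
    rw [e]; infer_instance
  rw [spikeMixture, ← pi_sum_smul q fun j x => ENNReal.ofReal (spikeWeight o v (a j) x)]
  simp only [e]

theorem lintegral_spikeMixture (o v : Fin k) {a : Fin n → ℝ} (ha : ∀ j, 0 ≤ a j ∧ a j ≤ 1)
    (F : (Fin n → Msg) → ℝ≥0∞) :
    ∫⁻ y, F y ∂(spikeMixture q o v a) = ∑ x : Fin n → Fin k,
      (∏ j, ENNReal.ofReal (spikeWeight o v (a j) (x j))) *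
        ∫⁻ y, F y ∂(Measure.pi fun j => q j (x j)) := by
  rw [spikeMixture_eq_sum o v ha, lintegral_finsetSum_measure]
  simp only [lintegral_smul_measure, smul_eq_mul]

/-- Fano-type bound: if the total relative entropy is at most `log k / 8`, no test recovers a
uniformly random `v` with probability more than `7 / 8`. -/
theorem sum_integral_spikeMixture_le (hε : 0 ≤ ε)
    (hq : ∀ j x x' S, MeasurableSet S → q j x S ≤ ENNReal.ofReal (Real.exp ε) * q j x' S)
    (hk : 2 ≤ k) (o : Fin k) {a : Fin n → ℝ} (ha : ∀ j, 0 ≤ a j ∧ a j ≤ 1)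
    (hkl : ∑ j, klBound ε (a j) ≤ Real.log k / 8)
    {φ : Fin k → (Fin n → Msg) → ℝ} (hφ : ∀ v, Measurable (φ v)) (h0 : ∀ v y, 0 ≤ φ v y)
    (h1 : ∀ y, ∑ v, φ v y ≤ 1) :
    ∑ v, ∫ y, φ v y ∂(spikeMixture q o v a) ≤ 7 / 8 * k := by
  have hφ1 : ∀ v y, φ v y ≤ 1 := fun v y =>
    (Finset.single_le_sum (fun v _ => h0 v y) (Finset.mem_univ v)).trans (h1 y)
  have hk' : (2 : ℝ) ≤ k := by exact_mod_cast hk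
  have hlogpos : 0 < Real.log k := Real.log_pos (by linarith)
  -- The change-of-measure bound with `l = log k`, so that `e^l - 1 = k - 1`.
  have hone : ∀ v, Real.log k * ∫ y, φ v y ∂(spikeMixture q o v a) ≤
      Real.log k / 8 + (k - 1) * ∫ y, φ v y ∂(Measure.pi fun j => q j o) := by
    intro v
    choose f hfm hfb hfd using fun j => exists_density_of_le_exp_mul (hq j v o) (hq j o v)
    have hfint : ∀ j, ∫ y, f j y ∂(q j o) = 1 := fun j => by
      have hpos : ∀ y, 0 ≤ f j y := fun y => (Real.exp_pos _).le.trans (hfb j y).1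
      have h : q j v Set.univ = 1 := measure_univ
      rw [hfd j, withDensity_apply _ MeasurableSet.univ, Measure.restrict_univ] at h
      rw [integral_eq_lintegral_of_nonneg_ae (.of_forall hpos) (hfm j).aestronglyMeasurable, h]
      simp
    let g : Fin n → Msg → ℝ := fun j y => 1 - a j + a j * f j y
    have hgm : ∀ j, Measurable (g j) := fun j => by fun_prop
    have hexp : Real.exp (-ε) ≤ 1 := Real.exp_le_one_iff.2 (by linarith)
    have hexp' : 1 ≤ Real.exp ε := Real.one_le_exp hε
    have hgb : ∀ j y, Real.exp (-ε) ≤ g j y ∧ g j y ≤ Real.exp ε := fun j y => by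
      have h1 := mul_le_mul_of_nonneg_left (hfb j y).1 (ha j).1
      have h2 := mul_le_mul_of_nonneg_left (hfb j y).2 (ha j).1
      have h3 := mul_le_mul_of_nonneg_left hexp (sub_nonneg.2 (ha j).2)
      have h4 := mul_le_mul_of_nonneg_left hexp' (sub_nonneg.2 (ha j).2)
      constructor <;> simp only [g] <;> linarith
    have hgint : ∀ j, ∫ y, g j y ∂(q j o) = 1 := fun j => by
      have hfi : Integrable (f j) (q j o) :=
        integrable_of_measurable_of_mem_Icc (hfm j) (hfb j)
      simp only [g]
      rw [integral_add (integrable_const _) (hfi.const_mul _), integral_const_mul, hfint]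
      simp
    have hgd : ∀ j, ENNReal.ofReal (1 - a j) • q j o + ENNReal.ofReal (a j) • q j v =
        (q j o).withDensity fun y => ENNReal.ofReal (g j y) := fun j => by
      have e : (fun y => ENNReal.ofReal (g j y)) = (fun _ => ENNReal.ofReal (1 - a j)) +
          ENNReal.ofReal (a j) • fun y => ENNReal.ofReal (f j y) := by
        funext y
        simp only [g, Pi.add_apply, Pi.smul_apply, smul_eq_mul]
        rw [ENNReal.ofReal_add (sub_nonneg.2 (ha j).2)
          (mul_nonneg (ha j).1 ((Real.exp_pos _).le.trans (hfb j y).1)),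
          ENNReal.ofReal_mul (ha j).1]
      rw [e, withDensity_add_left measurable_const, withDensity_const,
        withDensity_smul _ (hfm j).ennreal_ofReal, ← hfd j]
    have hsf : ∀ j, SigmaFinite ((q j o).withDensity fun y => ENNReal.ofReal (g j y)) := fun j => by
      have := isProbabilityMeasure_ofReal_smul_add (q j o) (q j v) (ha j).1 (ha j).2
      rw [← hgd]; infer_instance
    have hmain := mul_integral_pi_withDensity_le (ν := fun j => q j o) hgm (Real.exp_pos (-ε)) hgb
      hgint (hφ v) (h0 v) (hφ1 v) (Real.log k)
    rw [Real.exp_log (by linarith)] at hmain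
    have hsum : ∑ j, ∫ y, g j y * Real.log (g j y) ∂(q j o) ≤ Real.log k / 8 :=
      (Finset.sum_le_sum fun j _ => integral_mix_mul_log_le hε (ha j).1 (ha j).2 (hfm j) (hfb j)
        (hfint j)).trans hkl
    simp only [spikeMixture, hgd]
    linarith
  -- When every user holds `o` the law does not depend on `v`, so the `k` tests share a total mass
  -- of at most one.
  have hbase : ∑ v, ∫ y, φ v y ∂(Measure.pi fun j => q j o) ≤ 1 := by
    have hi : ∀ v, Integrable (φ v) (Measure.pi fun j => q j o) := fun v =>
      integrable_of_measurable_of_mem_Icc (hφ v) fun y => ⟨h0 v y, hφ1 v y⟩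
    rw [← integral_finsetSum _ fun v _ => hi v]
    refine (integral_mono (integrable_finsetSum _ fun v _ => hi v) (integrable_const 1) h1).trans ?_
    simp
  have hsum := Finset.sum_le_sum fun v (_ : v ∈ Finset.univ) => hone v
  rw [← Finset.mul_sum, Finset.sum_add_distrib, ← Finset.mul_sum] at hsum
  simp only [Finset.sum_const, Finset.card_univ, Fintype.card_fin, nsmul_eq_mul] at hsum
  -- After division by `k log k` the two contributions are `1/8` and `3/4`, hence `7/8`.
  have h3 := natCast_sub_one_le_mul_log hk
  have h4 := mul_le_mul_of_nonneg_left hbase (by linarith : (0 : ℝ) ≤ k - 1)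
  refine le_of_mul_le_mul_left ?_ hlogpos
  linarith

/-- The failure probabilities of a randomised test. -/
theorem le_sum_failure (hε : 0 ≤ ε)
    (hq : ∀ j x x' S, MeasurableSet S → q j x S ≤ ENNReal.ofReal (Real.exp ε) * q j x' S)
    (hk : 2 ≤ k) (o : Fin k) {a : Fin n → ℝ} (ha : ∀ j, 0 ≤ a j ∧ a j ≤ 1)
    (hkl : ∑ j, klBound ε (a j) ≤ Real.log k / 8)
    {Out : Type*} [MeasurableSpace Out] (κ : Kernel (Fin n → Msg) Out) [IsMarkovKernel κ]
    {B : Fin k → Set Out} (hB : ∀ v, MeasurableSet (B v)) (hdis : Pairwise (Function.onFun Disjoint B)) :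
    ENNReal.ofReal (k / 8) ≤ ∑ v, ∫⁻ y, κ y (B v)ᶜ ∂(spikeMixture q o v a) := by
  have hm : ∀ v, Measurable fun y => (κ y).real (B v) := fun v =>
    (κ.measurable_coe (hB v)).ennreal_toReal
  have hfano := sum_integral_spikeMixture_le hε hq hk o ha hkl (φ := fun v y => (κ y).real (B v)) hm
    (fun v y => measureReal_nonneg) fun y => by
      rw [← measureReal_iUnion_fintype hdis hB]
      exact measureReal_le_one
  have e : ∀ v, ∫⁻ y, κ y (B v)ᶜ ∂(spikeMixture q o v a) =
      ENNReal.ofReal (1 - ∫ y, (κ y).real (B v) ∂(spikeMixture q o v a)) := fun v => by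
    have := isProbabilityMeasure_spikeMixture (q := q) o v ha
    have hi : Integrable (fun y => (κ y).real (B v)) (spikeMixture q o v a) :=
      integrable_of_measurable_of_mem_Icc (hm v) fun y => ⟨measureReal_nonneg, measureReal_le_one⟩
    have h1 : ∫ y, (1 - (κ y).real (B v)) ∂(spikeMixture q o v a) =
        1 - ∫ y, (κ y).real (B v) ∂(spikeMixture q o v a) := by
      rw [integral_sub (integrable_const _) hi]; simp
    have h2 := ofReal_integral_eq_lintegral_ofReal ((integrable_const (1 : ℝ)).sub hi)
      (.of_forall fun y => sub_nonneg.2 measureReal_le_one)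
    simp only [Pi.sub_apply] at h2
    rw [← h1, h2]
    refine lintegral_congr fun y => ?_
    rw [← probReal_compl_eq_one_sub (hB v), ofReal_measureReal]
  simp only [e]
  rw [← ENNReal.ofReal_sum_of_nonneg]
  · refine ENNReal.ofReal_le_ofReal ?_
    rw [Finset.sum_sub_distrib]
    simp
    linarith
  · intro v _
    have := isProbabilityMeasure_spikeMixture (q := q) o v ha
    rw [sub_nonneg]
    refine (integral_mono (integrable_of_measurable_of_mem_Icc (hm v)
      fun y => ⟨measureReal_nonneg, measureReal_le_one⟩) (integrable_const 1)
      fun y => measureReal_le_one).trans ?_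
    simp

/-- Forcing user `j` to hold `v` changes the law of the messages by a factor at most `e^ε`. -/
theorem spikeMixture_le_smul_update
    (hq : ∀ j x x' S, MeasurableSet S → q j x S ≤ ENNReal.ofReal (Real.exp ε) * q j x' S)
    (o v : Fin k) {a : Fin n → ℝ} (ha : ∀ j, 0 ≤ a j ∧ a j ≤ 1) (j : Fin n) :
    spikeMixture q o v a ≤
      ENNReal.ofReal (Real.exp ε) • spikeMixture q o v (Function.update a j 1) := by
  have hμ := isProbabilityMeasure_ofReal_smul_add (q j o) (q j v) (ha j).1 (ha j).2
  have hcomb : ∀ c : ℝ≥0∞, ENNReal.ofReal (1 - a j) * c + ENNReal.ofReal (a j) * c = c :=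
    fun c => by
      rw [← add_mul, ← ENNReal.ofReal_add (sub_nonneg.2 (ha j).2) (ha j).1]; simp
  obtain ⟨h, hm, hb, hd⟩ := exists_density_of_le_exp_mul
    (μ := ENNReal.ofReal (1 - a j) • q j o + ENNReal.ofReal (a j) • q j v) (ν := q j v) (ε := ε)
    (fun S hS => by
      simp only [Measure.add_apply, Measure.smul_apply, smul_eq_mul]
      refine le_trans ?_ (hcomb _).le
      gcongr
      exacts [hq j o v S hS, hq j v v S hS])
    (fun S hS => by
      simp only [Measure.add_apply, Measure.smul_apply, smul_eq_mul]
      refine (hcomb _).ge.trans ?_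
      rw [mul_add, mul_left_comm (ENNReal.ofReal (Real.exp ε)),
        mul_left_comm (ENNReal.ofReal (Real.exp ε))]
      gcongr
      exacts [hq j v o S hS, hq j v v S hS])
  let b := Function.update a j 1
  have hb01 : ∀ i, 0 ≤ b i ∧ b i ≤ 1 := fun i => by
    by_cases hi : i = j
    · subst hi; simp [b]
    · simpa [b, hi] using ha i
  let ν : Fin n → Measure Msg := fun i =>
    ENNReal.ofReal (1 - b i) • q i o + ENNReal.ofReal (b i) • q i v
  have hν : ∀ i, IsProbabilityMeasure (ν i) := fun i =>
    isProbabilityMeasure_ofReal_smul_add _ _ (hb01 i).1 (hb01 i).2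
  -- Only coordinate `j` changes, so the product density collapses to `h (y j)`, which is at most
  -- `e^ε`.
  let g : Fin n → Msg → ℝ := fun i => if i = j then h else fun _ => 1
  have hpos : ∀ y, 0 ≤ h y := fun y => (Real.exp_pos _).le.trans (hb y).1
  have hgm : ∀ i, Measurable (g i) := fun i => by
    by_cases hi : i = j <;> simp only [g, hi, if_true, if_false]
    exacts [hm, measurable_const]
  have hg0 : ∀ i y, 0 ≤ g i y := fun i y => by
    by_cases hi : i = j <;> simp [g, hi, hpos]
  have hgd : ∀ i, ENNReal.ofReal (1 - a i) • q i o + ENNReal.ofReal (a i) • q i v =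
      (ν i).withDensity fun y => ENNReal.ofReal (g i y) := fun i => by
    by_cases hi : i = j
    · subst hi; simp [g, ν, b, hd]
    · simp [g, ν, b, hi]
  have hsf : ∀ i, SigmaFinite ((ν i).withDensity fun y => ENNReal.ofReal (g i y)) := fun i => by
    have := isProbabilityMeasure_ofReal_smul_add (q i o) (q i v) (ha i).1 (ha i).2
    rw [← hgd]; infer_instance
  have hprod : ∀ y : Fin n → Msg, ∏ i, g i (y i) = h (y j) := fun y => by
    rw [Finset.prod_eq_single j]
    · simp [g]
    · intro i _ hi; simp [g, hi]
    · simp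
  simp only [spikeMixture, hgd]
  rw [pi_withDensity_ofReal hgm hg0, ← withDensity_const]
  refine withDensity_mono (.of_forall fun y => ?_)
  simp only [hprod]
  exact ENNReal.ofReal_le_ofReal (hb _).2

end FixedSeed

/-! ### Decoding the spike from the output -/

section Decoding

variable {k : ℕ}

/-- The outputs decoded as `v`: the base symbol `o` when no other coordinate exceeds the threshold
`τ`, and otherwise the largest coordinate different from `o`. -/
def decodeSet (o : Fin k) (τ : ℝ) (v : Fin k) : Set (Fin k → ℝ) :=
  {u | (v = o ∧ ∀ w, w ≠ o → u w ≤ τ) ∨ (v ≠ o ∧ τ < u v ∧ ∀ w, w ≠ o → w ≠ v → u w < u v)}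

theorem measurableSet_decodeSet (o : Fin k) (τ : ℝ) (v : Fin k) :
    MeasurableSet (decodeSet o τ v) := by
  have h1 : MeasurableSet {u : Fin k → ℝ | ∀ w, w ≠ o → u w ≤ τ} := by
    simp only [Set.ofPred_forall]
    exact .iInter fun w => .iInter fun _ => measurableSet_le (measurable_pi_apply w) measurable_const
  have h2 : MeasurableSet {u : Fin k → ℝ | ∀ w, w ≠ o → w ≠ v → u w < u v} := by
    simp only [Set.ofPred_forall]
    exact .iInter fun w => .iInter fun _ => .iInter fun _ =>
      measurableSet_lt (measurable_pi_apply w) (measurable_pi_apply v)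
  have h3 : MeasurableSet {u : Fin k → ℝ | τ < u v} :=
    measurableSet_lt measurable_const (measurable_pi_apply v)
  exact ((MeasurableSet.const _).inter h1).union ((MeasurableSet.const _).inter (h3.inter h2))

theorem pairwise_disjoint_decodeSet (o : Fin k) (τ : ℝ) :
    Pairwise (Function.onFun Disjoint (decodeSet o τ)) := by
  intro v w hvw
  rw [Function.onFun, Set.disjoint_left]
  rintro u (⟨rfl, h⟩ | ⟨hv, h, h'⟩) (⟨hw, h2⟩ | ⟨hw, h2, h2'⟩)
  · exact hvw hw.symm
  · exact (h w hw).not_gt h2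
  · exact (h2 v hv).not_gt h
  · exact lt_asymm (h' w hw hvw.symm) (h2' v hv hvw)

/-- Failure exhibits a coordinate above `τ` where the target is zero. Keeping `o` among the
hypotheses leaves two of them even when `k = 2`. -/
theorem le_norm_of_notMem_decodeSet_self {o : Fin k} {τ : ℝ} {u t : Fin k → ℝ}
    (ht : ∀ w, w ≠ o → t w = 0) (hu : u ∉ decodeSet o τ o) : τ ≤ ‖u - t‖ := by
  simp only [decodeSet, Set.mem_ofPred_eq, true_and, ne_eq, not_true_eq_false, false_and, or_false,
    not_forall, not_le] at hu
  obtain ⟨w, hw, h⟩ := hu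
  have := (le_abs_self _).trans (norm_le_pi_norm (u - t) w)
  rw [Pi.sub_apply, ht w hw] at this
  linarith

/-- Either `u v ≤ τ`, or some rival `w` with zero target has `u w ≥ u v`; in the latter case the
errors at `v` and `w` add up to at least `t v`. -/
theorem le_norm_of_notMem_decodeSet {o v : Fin k} (hv : v ≠ o) {τ : ℝ} (hτ : 0 ≤ τ)
    {u t : Fin k → ℝ} (ht : ∀ w, w ≠ o → w ≠ v → t w = 0) (hu : u ∉ decodeSet o τ v) :
    t v / 2 - τ ≤ ‖u - t‖ := by
  have hn := norm_nonneg (u - t)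
  have h1 := (neg_le_abs _).trans (norm_le_pi_norm (u - t) v)
  rw [Pi.sub_apply] at h1
  by_cases h : u v ≤ τ
  · linarith
  · have : ∃ w, w ≠ o ∧ w ≠ v ∧ u v ≤ u w := by
      by_contra! hcon
      exact hu (Or.inr ⟨hv, not_le.1 h, hcon⟩)
    obtain ⟨w, hwo, hwv, hle⟩ := this
    have h2 := (le_abs_self _).trans (norm_le_pi_norm (u - t) w)
    rw [Pi.sub_apply, ht w hwo hwv] at h2
    linarith

end Decoding

/-! ### From failure probabilities to losses, and averaging over the seed -/

theorem ofReal_mul_measure_compl_le_lintegral {Out : Type*} [MeasurableSpace Out] (μ : Measure Out)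
    {B : Set Out} (hB : MeasurableSet B) {c : ℝ} {f : Out → ℝ} (h : ∀ u, u ∉ B → c ≤ f u) :
    ENNReal.ofReal c * μ Bᶜ ≤ ∫⁻ u, ENNReal.ofReal (f u) ∂μ := by
  rw [← setLIntegral_const]
  exact (setLIntegral_mono' hB.compl fun u hu => ENNReal.ofReal_le_ofReal (h u hu)).trans
    (setLIntegral_le_lintegral _ _)

theorem measurable_pi_kernel {ι α Ω : Type*} [Fintype ι] [MeasurableSpace α] [MeasurableSpace Ω]
    (κ : ι → Kernel α Ω) [∀ j, IsMarkovKernel (κ j)] :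
    Measurable fun r => Measure.pi fun j => κ j r := by
  refine Measurable.measure_of_isPiSystem_of_isProbabilityMeasure generateFrom_pi.symm
    isPiSystem_pi ?_
  rintro _ ⟨S, hS, rfl⟩
  simp only [Measure.pi_pi]
  exact Finset.measurable_prod _ fun j _ => (κ j).measurable_coe (hS j trivial)

namespace NonInteractiveProtocol

variable {Seed Msg : Type*} [MeasurableSpace Seed] [MeasurableSpace Msg] {k n : ℕ}
  (P : NonInteractiveProtocol Seed Msg k n)

instance : IsProbabilityMeasure P.seedLaw := P.isProbabilityMeasure_seedLaw

instance (j : Fin n) : IsMarkovKernel (P.randomizer j) := P.isMarkovKernel_randomizer j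

instance : IsMarkovKernel P.server := P.isMarkovKernel_server

/-- The expected loss for a given value of the seed. -/
noncomputable def seedLoss (r : Seed) (x : Fin n → Fin k) (t : Fin k → ℝ) : ℝ≥0∞ :=
  ∫⁻ y, ∫⁻ v, ENNReal.ofReal ‖v - t‖ ∂(P.server (r, y))
    ∂(Measure.pi fun j => P.randomizer j (r, x j))

theorem expectedLoss_eq_lintegral_seedLoss (x : Fin n → Fin k) (t : Fin k → ℝ) :
    P.expectedLoss x t = ∫⁻ r, P.seedLoss r x t ∂P.seedLaw := rfl

theorem measurable_seedLoss (x : Fin n → Fin k) (t : Fin k → ℝ) :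
    Measurable fun r => P.seedLoss r x t := by
  have hm : ∀ j, Measurable fun r : Seed => (r, x j) := fun j => by fun_prop
  let κ : Kernel Seed (Fin n → Msg) :=
    ⟨_, measurable_pi_kernel fun j => (P.randomizer j).comap _ (hm j)⟩
  have hκ : IsMarkovKernel κ := ⟨fun r => by
    change IsProbabilityMeasure (Measure.pi _)
    infer_instance⟩
  have hF : Measurable fun p : Seed × (Fin n → Msg) =>
      ∫⁻ v, ENNReal.ofReal ‖v - t‖ ∂(P.server p) :=
    Measurable.lintegral_kernel (by fun_prop)
  exact Measurable.lintegral_kernel_prod_right' (κ := κ) hF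

/-- The probability that the output is not decoded as `v`, when the user data follow a spike
mixture and the seed is `r`. -/
noncomputable def failureProb (r : Seed) (o : Fin k) (τ : ℝ) (a : Fin n → ℝ) (v : Fin k) : ℝ≥0∞ :=
  ∫⁻ y, P.server (r, y) (decodeSet o τ v)ᶜ ∂(spikeMixture (fun j x => P.randomizer j (r, x)) o v a)

/-- The average loss at `v` for the seed `r` over datasets following the law
`(1 - α) δ_o + α δ_v`, the target depending on the dataset. -/
noncomputable def spikeLoss (r : Seed) (o : Fin k) (α : ℝ) (v : Fin k)
    (t : (Fin n → Fin k) → Fin k → ℝ) : ℝ≥0∞ :=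
  ∑ x : Fin n → Fin k, (∏ j, ENNReal.ofReal (spikeWeight o v α (x j))) * P.seedLoss r x (t x)

variable {P} {r : Seed} {o : Fin k} {τ α ε : ℝ} {a : Fin n → ℝ}

theorem failureProb_eq_sum (ha : ∀ j, 0 ≤ a j ∧ a j ≤ 1) (v : Fin k) :
    P.failureProb r o τ a v = ∑ x : Fin n → Fin k,
      (∏ j, ENNReal.ofReal (spikeWeight o v (a j) (x j))) *
        ∫⁻ y, P.server (r, y) (decodeSet o τ v)ᶜ ∂(Measure.pi fun j => P.randomizer j (r, x j)) :=
  lintegral_spikeMixture o v ha _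

theorem failureProb_le_one (ha : ∀ j, 0 ≤ a j ∧ a j ≤ 1) (v : Fin k) :
    P.failureProb r o τ a v ≤ 1 := by
  have := isProbabilityMeasure_spikeMixture (q := fun j x => P.randomizer j (r, x)) o v ha
  refine (lintegral_mono fun y => prob_le_one).trans ?_
  simp

theorem IsLDP.le_sum_failureProb (hP : P.IsLDP ε) (hε : 0 ≤ ε) (hk : 2 ≤ k)
    (ha : ∀ j, 0 ≤ a j ∧ a j ≤ 1) (hkl : ∑ j, klBound ε (a j) ≤ Real.log k / 8) :
    ENNReal.ofReal (k / 8) ≤ ∑ v, P.failureProb r o τ a v :=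
  le_sum_failure hε (hP r) hk o ha hkl (P.server.comap (fun y => (r, y)) (by fun_prop))
    (measurableSet_decodeSet o τ) (pairwise_disjoint_decodeSet o τ)

theorem IsLDP.failureProb_le_mul_update (hP : P.IsLDP ε)
    (ha : ∀ j, 0 ≤ a j ∧ a j ≤ 1) (j : Fin n) (v : Fin k) :
    P.failureProb r o τ a v ≤
      ENNReal.ofReal (Real.exp ε) * P.failureProb r o τ (Function.update a j 1) v := by
  refine (lintegral_mono' (spikeMixture_le_smul_update (hP r) o v ha j) le_rfl).trans ?_
  rw [lintegral_smul_measure, smul_eq_mul]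
  rfl

/-- If the target vanishes off `o` on all datasets of positive weight, then the average loss is at
least `τ` times the failure probability. -/
theorem mul_failureProb_le_spikeLoss (h0 : 0 ≤ α) (h1 : α ≤ 1) {v : Fin k} {c : ℝ}
    {t : (Fin n → Fin k) → Fin k → ℝ}
    (ht : ∀ x : Fin n → Fin k, (∀ j, spikeWeight o v α (x j) ≠ 0) →
      ∀ u, u ∉ decodeSet o τ v → c ≤ ‖u - t x‖) :
    ENNReal.ofReal c * P.failureProb r o τ (fun _ => α) v ≤ P.spikeLoss r o α v t := by
  rw [failureProb_eq_sum fun _ => ⟨h0, h1⟩, spikeLoss, Finset.mul_sum]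
  refine Finset.sum_le_sum fun x _ => ?_
  rw [mul_left_comm]
  by_cases hx : ∀ j, spikeWeight o v α (x j) ≠ 0
  · gcongr
    rw [seedLoss, ← lintegral_const_mul' _ _ ENNReal.ofReal_ne_top]
    exact lintegral_mono fun y =>
      ofReal_mul_measure_compl_le_lintegral _ (measurableSet_decodeSet o τ v) (ht x hx)
  · push Not at hx
    obtain ⟨j, hj⟩ := hx
    rw [Finset.prod_eq_zero (Finset.mem_univ j) (by rw [hj, ENNReal.ofReal_zero])]
    simp

/-- Averaging bounds valid for every seed gives a lower bound on a worst-case error. -/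
theorem ofReal_le_of_forall_le_sum_spikeLoss (hk : 1 ≤ k) {C : ℝ}
    {t : Fin k → (Fin n → Fin k) → Fin k → ℝ} {E : ℝ≥0∞}
    (h : ∀ r, ENNReal.ofReal (C * k) ≤ ∑ v, P.spikeLoss r o α v (t v))
    (hE : ∀ v, ∑ x : Fin n → Fin k, (∏ j, ENNReal.ofReal (spikeWeight o v α (x j))) *
      P.expectedLoss x (t v x) ≤ E) :
    ENNReal.ofReal C ≤ E := by
  have h1 : ENNReal.ofReal (C * k) ≤ ∫⁻ r, ∑ v, P.spikeLoss r o α v (t v) ∂P.seedLaw := by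
    refine le_trans ?_ (lintegral_mono h)
    simp
  have hm : ∀ v x, Measurable fun r =>
      (∏ j, ENNReal.ofReal (spikeWeight o v α (x j))) * P.seedLoss r x (t v x) :=
    fun v x => (P.measurable_seedLoss x _).const_mul _
  simp only [spikeLoss] at h1
  rw [lintegral_finsetSum _ fun v _ => Finset.measurable_sum _ fun x _ => hm v x] at h1
  have h2 : ∀ v, ∫⁻ r, ∑ x : Fin n → Fin k, (∏ j, ENNReal.ofReal (spikeWeight o v α (x j))) *
      P.seedLoss r x (t v x) ∂P.seedLaw ≤ E := fun v => by
    refine le_trans (le_of_eq ?_) (hE v)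
    rw [lintegral_finsetSum _ fun x _ => hm v x]
    refine Finset.sum_congr rfl fun x _ => ?_
    rw [lintegral_const_mul _ (P.measurable_seedLoss x _), expectedLoss_eq_lintegral_seedLoss]
  have h3 := h1.trans (Finset.sum_le_card_nsmul _ _ _ fun v _ => h2 v)
  rw [Finset.card_univ, Fintype.card_fin, nsmul_eq_mul, mul_comm C,
    ENNReal.ofReal_mul (by positivity), ENNReal.ofReal_natCast] at h3
  have hk0 : (k : ℝ≥0∞) ≠ 0 := by exact_mod_cast (by omega : k ≠ 0)
  exact (ENNReal.mul_le_mul_iff_right hk0 (ENNReal.natCast_ne_top k)).1 h3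

end NonInteractiveProtocol

/-! ### Matching the rate with the entropy budget -/

section Rate

variable {k n : ℕ} {ε α : ℝ}

theorem ldpRate_nonneg (k n : ℕ) (ε : ℝ) : 0 ≤ ldpRate k n ε :=
  ((Real.sqrt_nonneg _).trans (le_max_left _ _)).trans (le_max_left _ _)

theorem ldpRate_eq_zero_of_log_eq_zero (h : Real.log k = 0) : ldpRate k n ε = 0 := by
  simp [ldpRate, h]

/-- The rate is a maximum of three terms and `klBound` a minimum of three: whichever term attains
the maximum, the corresponding entry of the minimum gives the bound. -/
theorem natCast_mul_klBound_le (hn : 1 ≤ n) (hε : 0 < ε) (h0 : 0 ≤ α)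
    (hα : α ≤ ldpRate k n ε / 16) : n * klBound ε α ≤ Real.log k / 16 := by
  have hlog : 0 ≤ Real.log k := Real.log_natCast_nonneg k
  have hn' : (0 : ℝ) < n := by exact_mod_cast hn
  have hexp : 0 < Real.exp ε - 1 := by linarith [Real.add_one_lt_exp hε.ne']
  have hsq : ∀ D : ℝ, 0 < D → α ≤ Real.sqrt (Real.log k / (n * D)) / 16 →
      n * (α ^ 2 * D) ≤ Real.log k / 16 := fun D hD h => by
    have h1 : α ^ 2 ≤ (Real.sqrt (Real.log k / (n * D)) / 16) ^ 2 := by gcongr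
    rw [div_pow, Real.sq_sqrt (by positivity)] at h1
    have h2 : n * D * α ^ 2 ≤ n * D * (Real.log k / (n * D) / 16 ^ 2) := by gcongr
    have h3 : n * D * (Real.log k / (n * D) / 16 ^ 2) = Real.log k / 16 ^ 2 := by field_simp
    linarith
  unfold klBound
  rcases max_cases (max (Real.sqrt (Real.log k / (n * (Real.exp ε - 1) ^ 2)))
      (Real.sqrt (Real.log k / (n * Real.exp ε)))) (Real.log k / (n * ε)) with ⟨h, -⟩ | ⟨h, -⟩ <;>
    rw [ldpRate, h] at hα
  · rcases max_cases (Real.sqrt (Real.log k / (n * (Real.exp ε - 1) ^ 2)))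
      (Real.sqrt (Real.log k / (n * Real.exp ε))) with ⟨h, -⟩ | ⟨h, -⟩ <;> rw [h] at hα
    · refine le_trans ?_ (hsq _ (by positivity) hα)
      gcongr
      exact (min_le_left _ _).trans (min_le_left _ _)
    · refine le_trans ?_ (hsq _ (by positivity) hα)
      gcongr
      exact (min_le_left _ _).trans (min_le_right _ _)
  · have h2 : n * ε * α ≤ n * ε * (Real.log k / (n * ε) / 16) := by gcongr
    have h3 : n * ε * (Real.log k / (n * ε) / 16) = Real.log k / 16 := by field_simp
    calc n * _ ≤ n * (α * ε) := by gcongr; exact min_le_right _ _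
      _ ≤ _ := by linarith

theorem sum_klBound_const_le (hn : 1 ≤ n) (hε : 0 < ε) (h0 : 0 ≤ α)
    (hα : α ≤ ldpRate k n ε / 16) : ∑ _j : Fin n, klBound ε α ≤ Real.log k / 8 := by
  have := natCast_mul_klBound_le hn hε h0 hα
  have hlog : 0 ≤ Real.log k := Real.log_natCast_nonneg k
  simp only [Finset.sum_const, Finset.card_univ, Fintype.card_fin, nsmul_eq_mul]
  linarith

theorem klBound_nonneg (hε : 0 ≤ ε) (h0 : 0 ≤ α) : 0 ≤ klBound ε α := by
  unfold klBound
  positivity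

/-- The forced user costs at most `klBound ε 1 ≤ ε ≤ log k / 16`. The remaining half of Fano's
budget `log k / 8` pays for the others. -/
theorem sum_klBound_update_le (hn : 1 ≤ n) (hε : 0 < ε) (h0 : 0 ≤ α)
    (hα : α ≤ ldpRate k n ε / 16) (hεk : ε ≤ Real.log k / 16) (j : Fin n) :
    ∑ i, klBound ε (Function.update (fun _ => α) j 1 i) ≤ Real.log k / 8 := by
  have h1 := natCast_mul_klBound_le hn hε h0 hα
  have h2 : ∀ i, klBound ε (Function.update (fun _ => α) j 1 i) ≤
      klBound ε α + if i = j then ε else 0 := fun i => by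
    by_cases hi : i = j
    · subst hi
      have : klBound ε 1 ≤ 1 * ε := min_le_right _ _
      have := klBound_nonneg hε.le h0
      simp only [Function.update_self, if_true]
      linarith
    · simp [hi]
  refine (Finset.sum_le_sum fun i _ => h2 i).trans ?_
  rw [Finset.sum_add_distrib]
  simp
  linarith

end Rate

theorem eq_or_eq_of_spikeWeight_ne_zero {k : ℕ} {o v x : Fin k} {α : ℝ}
    (h : spikeWeight o v α x ≠ 0) : x = o ∨ x = v := by
  by_contra! hx
  simp [spikeWeight, hx.1, hx.2] at h

theorem spikeWeight_of_ne {k : ℕ} {o v x : Fin k} {α : ℝ} (ho : x ≠ o) (hv : x ≠ v) :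
    spikeWeight o v α x = 0 := by
  simp [spikeWeight, ho, hv]

/-- Weighting by the indicator of `x j = v` amounts to forcing user `j` to hold `v`. -/
theorem prod_spikeWeight_mul_ite {k n : ℕ} {o v : Fin k} (hv : v ≠ o) {α : ℝ}
    (x : Fin n → Fin k) (j : Fin n) :
    (∏ i, ENNReal.ofReal (spikeWeight o v α (x i))) * (if x j = v then 1 else 0) =
      ENNReal.ofReal α * ∏ i, ENNReal.ofReal
        (spikeWeight o v (Function.update (fun _ => α) j 1 i) (x i)) := by
  rw [← Finset.mul_prod_erase _ _ (Finset.mem_univ j),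
    ← Finset.mul_prod_erase _ (fun i => ENNReal.ofReal (spikeWeight o v _ (x i)))
      (Finset.mem_univ j), Function.update_self]
  have : ∏ i ∈ Finset.univ.erase j, ENNReal.ofReal
      (spikeWeight o v (Function.update (fun _ => α) j 1 i) (x i)) =
      ∏ i ∈ Finset.univ.erase j, ENNReal.ofReal (spikeWeight o v α (x i)) :=
    Finset.prod_congr rfl fun i hi => by
      rw [Function.update_of_ne (Finset.ne_of_mem_erase hi)]
  rw [this]
  by_cases hj : x j = v
  · simp [hj, spikeWeight, hv]
  · simp [hj, spikeWeight]

/-! ### Lower bounds for the two estimation errors -/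

namespace NonInteractiveProtocol

variable {Seed Msg : Type*} [MeasurableSpace Seed] [MeasurableSpace Msg] {k n : ℕ}
  {P : NonInteractiveProtocol Seed Msg k n} {r : Seed} {o : Fin k} {τ α ε : ℝ}

theorem IsLDP.ofReal_le_worstCaseDistributionError (hP : P.IsLDP ε) (hk : 2 ≤ k) (hn : 1 ≤ n)
    (hε : 0 < ε) (h0 : 0 ≤ α) (h1 : α ≤ 1) (hα : α ≤ ldpRate k n ε / 16) :
    ENNReal.ofReal (α / 512) ≤ P.worstCaseDistributionError := by
  let o : Fin k := ⟨0, by omega⟩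
  refine ofReal_le_of_forall_le_sum_spikeLoss (P := P) (o := o) (α := α)
    (t := fun v _ => spikeWeight o v α) (by omega) (fun r => ?_) fun v => ?_
  · have hfano := hP.le_sum_failureProb (r := r) (o := o) (τ := α / 64) hε.le hk
      (a := fun _ => α) (fun _ => ⟨h0, h1⟩) (sum_klBound_const_le hn hε h0 hα)
    have hloss : ∀ v, ENNReal.ofReal (α / 64) * P.failureProb r o (α / 64) (fun _ => α) v ≤
        P.spikeLoss r o α v fun _ => spikeWeight o v α := fun v => by
      refine mul_failureProb_le_spikeLoss h0 h1 fun x _ u hu => ?_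
      by_cases hv : v = o
      · rw [hv] at hu ⊢
        exact le_norm_of_notMem_decodeSet_self (fun w hw => spikeWeight_of_ne hw hw) hu
      · refine le_trans ?_ (le_norm_of_notMem_decodeSet hv (by positivity)
          (fun w hw hw' => spikeWeight_of_ne hw hw') hu)
        have : spikeWeight o v α v = α := by simp [spikeWeight, hv]
        rw [this]
        linarith
    refine le_trans ?_ (Finset.sum_le_sum fun v _ => hloss v)
    rw [← Finset.mul_sum]
    refine le_trans (le_of_eq ?_) (mul_le_mul_right hfano _)
    rw [← ENNReal.ofReal_mul (by positivity)]
    congr 1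
    ring
  · refine le_trans (le_of_eq ?_) (le_iSup₂ (f := fun p (_ : p ∈ stdSimplex ℝ (Fin k)) =>
      P.distributionError p) (spikeWeight o v α) (spikeWeight_mem_stdSimplex h0 h1))
    refine Finset.sum_congr rfl fun x _ => ?_
    rw [ENNReal.ofReal_prod_of_nonneg fun j _ => spikeWeight_nonneg h0 h1 _]

/-- Lower bound for the loss in frequency estimation in terms of the failure probabilities when
one of the users is forced to hold `v`. -/
theorem sum_failureProb_update_le (hn : 1 ≤ n) (h0 : 0 ≤ α) (h1 : α ≤ 1) (hτ : 0 ≤ τ) {v : Fin k}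
    (hv : v ≠ o) :
    ENNReal.ofReal (α / (2 * n)) *
        ∑ j, P.failureProb r o τ (Function.update (fun _ => α) j 1) v ≤
      P.spikeLoss r o α v empiricalFrequency +
        ENNReal.ofReal τ * P.failureProb r o τ (fun _ => α) v := by
  have hn' : (0 : ℝ) < n := by exact_mod_cast hn
  have hu : ∀ j i : Fin n, 0 ≤ Function.update (fun _ => α) j 1 i ∧
      Function.update (fun _ => α) j 1 i ≤ 1 := fun j i => by
    by_cases hi : i = j
    · subst hi; simp
    · simp [hi, h0, h1]
  let C : (Fin n → Fin k) → ℝ≥0∞ := fun x =>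
    ∫⁻ y, P.server (r, y) (decodeSet o τ v)ᶜ ∂(Measure.pi fun j => P.randomizer j (r, x j))
  have hterm : ∀ x : Fin n → Fin k, (∀ j, spikeWeight o v α (x j) ≠ 0) →
      ENNReal.ofReal (1 / (2 * n)) * (∑ j, if x j = v then 1 else 0) * C x ≤
        P.seedLoss r x (empiricalFrequency x) + ENNReal.ofReal τ * C x := by
    intro x hx
    have hcount : ENNReal.ofReal (1 / (2 * n)) * (∑ j, if x j = v then 1 else 0) =
        ENNReal.ofReal (empiricalFrequency x v / 2) := by
      have : (∑ j, if x j = v then (1 : ℝ≥0∞) else 0) =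
          ENNReal.ofReal (∑ j, if x j = v then (1 : ℝ) else 0) := by
        rw [ENNReal.ofReal_sum_of_nonneg fun j _ => by positivity]
        refine Finset.sum_congr rfl fun j _ => ?_
        split_ifs <;> simp
      rw [this, ← ENNReal.ofReal_mul (by positivity), empiricalFrequency]
      congr 1
      field_simp
    rw [hcount]
    have hnorm : ∀ u, u ∉ decodeSet o τ v →
        empiricalFrequency x v / 2 - τ ≤ ‖u - empiricalFrequency x‖ := fun u hu => by
      refine le_norm_of_notMem_decodeSet hv hτ (fun w hwo hwv => ?_) hu
      have : ∀ j, x j ≠ w := fun j hj => by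
        rcases eq_or_eq_of_spikeWeight_ne_zero (hx j) with h | h
        exacts [hwo (hj ▸ h), hwv (hj ▸ h)]
      simp [empiricalFrequency, this]
    -- Moving `τ` to the other side avoids truncated subtraction: the inequality also holds when
    -- `q(x)_v / 2 < τ`.
    have hle : ENNReal.ofReal (empiricalFrequency x v / 2) ≤
        ENNReal.ofReal (empiricalFrequency x v / 2 - τ) + ENNReal.ofReal τ := by
      refine le_trans (ENNReal.ofReal_le_ofReal ?_) ENNReal.ofReal_add_le
      linarith
    refine (mul_le_mul_left hle _).trans ?_
    rw [add_mul]
    gcongr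
    rw [seedLoss, ← lintegral_const_mul' _ _ ENNReal.ofReal_ne_top]
    exact lintegral_mono fun y =>
      ofReal_mul_measure_compl_le_lintegral _ (measurableSet_decodeSet o τ v) hnorm
  have hsplit : ENNReal.ofReal (α / (2 * n)) = ENNReal.ofReal (1 / (2 * n)) * ENNReal.ofReal α := by
    rw [← ENNReal.ofReal_mul (by positivity)]
    congr 1
    ring
  calc ENNReal.ofReal (α / (2 * n)) *
        ∑ j, P.failureProb r o τ (Function.update (fun _ => α) j 1) v
      = ∑ x : Fin n → Fin k, (∏ i, ENNReal.ofReal (spikeWeight o v α (x i))) *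
          (ENNReal.ofReal (1 / (2 * n)) * (∑ j, if x j = v then 1 else 0) * C x) := by
        simp only [failureProb_eq_sum (hu _)]
        rw [Finset.sum_comm, Finset.mul_sum]
        refine Finset.sum_congr rfl fun x _ => ?_
        -- Size-biasing: weighting a dataset by the number of its users holding `v` equals `α` times
        -- the sum of the laws with one user forced to hold `v`.
        have key : (∏ i, ENNReal.ofReal (spikeWeight o v α (x i))) *
            (∑ j, if x j = v then 1 else 0) = ENNReal.ofReal α * ∑ j, ∏ i, ENNReal.ofReal
              (spikeWeight o v (Function.update (fun _ => α) j 1 i) (x i)) := by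
          rw [Finset.mul_sum, Finset.mul_sum]
          exact Finset.sum_congr rfl fun j _ => prod_spikeWeight_mul_ite hv x j
        rw [← Finset.sum_mul, hsplit]
        calc _ = ENNReal.ofReal (1 / (2 * n)) * (ENNReal.ofReal α * ∑ j, ∏ i, ENNReal.ofReal
              (spikeWeight o v (Function.update (fun _ => α) j 1 i) (x i))) * C x := by
              simp only [C]; ring
          _ = _ := by rw [← key]; ring
    _ ≤ ∑ x : Fin n → Fin k, (∏ i, ENNReal.ofReal (spikeWeight o v α (x i))) *
          (P.seedLoss r x (empiricalFrequency x) + ENNReal.ofReal τ * C x) := by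
        refine Finset.sum_le_sum fun x _ => ?_
        by_cases hx : ∀ j, spikeWeight o v α (x j) ≠ 0
        · gcongr
          exact hterm x hx
        · push Not at hx
          obtain ⟨j, hj⟩ := hx
          rw [Finset.prod_eq_zero (Finset.mem_univ j) (by rw [hj, ENNReal.ofReal_zero])]
          simp
    _ = _ := by
        rw [failureProb_eq_sum fun _ => ⟨h0, h1⟩, Finset.mul_sum, spikeLoss,
          ← Finset.sum_add_distrib]
        refine Finset.sum_congr rfl fun x _ => ?_
        rw [mul_add, mul_left_comm]

theorem mul_failureProb_self_le_spikeLoss_empiricalFrequency (h0 : 0 ≤ α) (h1 : α ≤ 1) :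
    ENNReal.ofReal τ * P.failureProb r o τ (fun _ => α) o ≤
      P.spikeLoss r o α o empiricalFrequency := by
  refine mul_failureProb_le_spikeLoss h0 h1 fun x hx u hu =>
    le_norm_of_notMem_decodeSet_self (fun w hw => ?_) hu
  have : ∀ j, x j ≠ w := fun j hj => by
    rcases eq_or_eq_of_spikeWeight_ne_zero (hx j) with h | h <;> exact hw (hj ▸ h)
  simp [empiricalFrequency, this]

/-- Frequency loss in the high privacy regime. -/
theorem IsLDP.le_sum_spikeLoss_of_le_one (hP : P.IsLDP ε) (hk : 2 ≤ k) (hn : 1 ≤ n)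
    (hε : 0 < ε) (hε1 : ε ≤ 1) (h0 : 0 ≤ α) (h1 : α ≤ 1) (hα : α ≤ ldpRate k n ε / 16) :
    ENNReal.ofReal (α / 512 * k) ≤ ∑ v, P.spikeLoss r o α v empiricalFrequency := by
  have hn' : (0 : ℝ) < n := by exact_mod_cast hn
  have hfano := hP.le_sum_failureProb (r := r) (o := o) (τ := α / 64) hε.le hk
    (a := fun _ => α) (fun _ => ⟨h0, h1⟩) (sum_klBound_const_le hn hε h0 hα)
  have hloss : ∀ v, ENNReal.ofReal (α / 64) * P.failureProb r o (α / 64) (fun _ => α) v ≤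
      P.spikeLoss r o α v empiricalFrequency := fun v => by
    by_cases hv : v = o
    · subst hv
      exact mul_failureProb_self_le_spikeLoss_empiricalFrequency h0 h1
    set W := P.failureProb r o (α / 64) (fun _ => α) v with hW
    have hWfin : W ≠ ∞ := ne_top_of_le_ne_top ENNReal.one_ne_top
      (failureProb_le_one (fun _ => ⟨h0, h1⟩) v)
    have hexp : Real.exp ε ≤ 3 := by
      have := Real.exp_le_exp.2 hε1
      linarith [Real.exp_one_lt_d9]
    have hj : ∀ j, W ≤ 3 * P.failureProb r o (α / 64) (Function.update (fun _ => α) j 1) v :=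
      fun j => by
        refine (hP.failureProb_le_mul_update (fun _ => ⟨h0, h1⟩) j v).trans ?_
        gcongr
        exact (ENNReal.ofReal_le_ofReal hexp).trans (by simp)
    have hsum : ENNReal.ofReal n * W ≤
        3 * ∑ j, P.failureProb r o (α / 64) (Function.update (fun _ => α) j 1) v := by
      rw [Finset.mul_sum]
      refine le_trans (le_of_eq ?_) (Finset.sum_le_sum fun j _ => hj j)
      simp
    have hmain := sum_failureProb_update_le (P := P) (r := r) hn h0 h1
      (by positivity : 0 ≤ α / 64) hv
    -- Here `α / 6` is `α / 2` divided by the bound `3` on `e^ε`; subtracting the threshold term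
    -- still leaves more than `α / 64`.
    have hkey : ENNReal.ofReal (α / 6) * W ≤
        P.spikeLoss r o α v empiricalFrequency + ENNReal.ofReal (α / 64) * W := by
      refine le_trans ?_ hmain
      have e1 : ENNReal.ofReal (α / 6) = ENNReal.ofReal (α / (6 * n)) * ENNReal.ofReal n := by
        rw [← ENNReal.ofReal_mul (by positivity)]
        congr 1
        field_simp
      have e2 : ENNReal.ofReal (α / (2 * n)) = ENNReal.ofReal (α / (6 * n)) * 3 := by
        rw [← ENNReal.ofReal_ofNat 3, ← ENNReal.ofReal_mul (by positivity)]
        congr 1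
        field_simp
        ring
      rw [e1, e2, mul_assoc, mul_assoc]
      gcongr
    have hfin : ENNReal.ofReal (α / 64) * W ≠ ∞ := ENNReal.mul_ne_top ENNReal.ofReal_ne_top hWfin
    refine (ENNReal.add_le_add_iff_right hfin).1 (le_trans ?_ hkey)
    rw [← add_mul, ← ENNReal.ofReal_add (by positivity) (by positivity)]
    gcongr
    linarith
  refine le_trans ?_ (Finset.sum_le_sum fun v _ => hloss v)
  rw [← Finset.mul_sum]
  refine le_trans (le_of_eq ?_) (mul_le_mul_right hfano _)
  rw [← ENNReal.ofReal_mul (by positivity)]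
  congr 1
  ring

/-- Frequency loss for a large alphabet. -/
theorem IsLDP.le_sum_spikeLoss_of_le_log (hP : P.IsLDP ε) (hk : 16 ≤ k) (hn : 1 ≤ n)
    (hε : 0 < ε) (hεk : ε ≤ Real.log k / 16) (h0 : 0 ≤ α) (h1 : α ≤ 1)
    (hα : α ≤ ldpRate k n ε / 16) :
    ENNReal.ofReal (α / 512 * k) ≤ ∑ v, P.spikeLoss r o α v empiricalFrequency := by
  have hn' : (0 : ℝ) < n := by exact_mod_cast hn
  have hk' : (16 : ℝ) ≤ k := by exact_mod_cast hk
  have hu : ∀ j i : Fin n, 0 ≤ Function.update (fun _ => α) j 1 i ∧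
      Function.update (fun _ => α) j 1 i ≤ 1 := fun j i => by
    by_cases hi : i = j
    · subst hi; simp
    · simp [hi, h0, h1]
  have hfano : ∀ j, ENNReal.ofReal (k / 16) ≤ ∑ v ∈ Finset.univ.erase o,
      P.failureProb r o (α / 64) (Function.update (fun _ => α) j 1) v := fun j => by
    have h := hP.le_sum_failureProb (r := r) (o := o) (τ := α / 64) hε.le (by omega) (hu j)
      (sum_klBound_update_le hn hε h0 hα hεk j)
    rw [← Finset.add_sum_erase _ _ (Finset.mem_univ o)] at h
    -- Discarding `v = o` costs at most one, which `k ≥ 16` absorbs into half of `k / 8`.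
    have h2 : ENNReal.ofReal (k / 16) + 1 ≤ ENNReal.ofReal (k / 8) := by
      rw [← ENNReal.ofReal_one, ← ENNReal.ofReal_add (by positivity) zero_le_one]
      exact ENNReal.ofReal_le_ofReal (by linarith)
    have h3 := (h2.trans h).trans (add_le_add_left (failureProb_le_one (hu j) o) _)
    rw [add_comm 1] at h3
    exact (ENNReal.add_le_add_iff_right ENNReal.one_ne_top).1 h3
  have hmain := Finset.sum_le_sum fun v (hv : v ∈ Finset.univ.erase o) =>
    sum_failureProb_update_le (P := P) (r := r) hn h0 h1 (by positivity : 0 ≤ α / 64)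
      (Finset.ne_of_mem_erase hv)
  rw [← Finset.mul_sum, Finset.sum_comm, Finset.sum_add_distrib, ← Finset.mul_sum] at hmain
  have hlow : ENNReal.ofReal (α / 32 * k) ≤ ENNReal.ofReal (α / (2 * n)) * ∑ j : Fin n,
      ∑ v ∈ Finset.univ.erase o,
        P.failureProb r o (α / 64) (Function.update (fun _ => α) j 1) v := by
    refine le_trans ?_ (mul_le_mul_right (Finset.sum_le_sum fun j _ => hfano j) _)
    simp only [Finset.sum_const, Finset.card_univ, Fintype.card_fin, nsmul_eq_mul]
    rw [← ENNReal.ofReal_natCast n, ← ENNReal.ofReal_mul (by positivity),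
      ← ENNReal.ofReal_mul (by positivity)]
    refine ENNReal.ofReal_le_ofReal (le_of_eq ?_)
    field_simp
    ring
  -- Bounding every failure probability by one suffices: `τ = α / 64` makes this exactly half of the
  -- lower bound `α k / 32`.
  have hup : ENNReal.ofReal (α / 64) * ∑ v ∈ Finset.univ.erase o,
      P.failureProb r o (α / 64) (fun _ => α) v ≤ ENNReal.ofReal (α / 64 * k) := by
    rw [ENNReal.ofReal_mul (by positivity), ENNReal.ofReal_natCast]
    gcongr
    refine (Finset.sum_le_sum_of_subset (Finset.subset_univ _)).trans ?_
    refine (Finset.sum_le_card_nsmul _ _ 1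
      fun v _ => failureProb_le_one (fun _ => ⟨h0, h1⟩) v).trans ?_
    simp
  have hsub : ∑ v ∈ Finset.univ.erase o, P.spikeLoss r o α v empiricalFrequency ≤
      ∑ v, P.spikeLoss r o α v empiricalFrequency :=
    Finset.sum_le_sum_of_subset (Finset.subset_univ _)
  have hall := hlow.trans (hmain.trans (add_le_add hsub hup))
  refine (ENNReal.add_le_add_iff_right (ENNReal.ofReal_ne_top (r := α / 64 * k))).1
    (le_trans ?_ hall)
  rw [← ENNReal.ofReal_add (by positivity) (by positivity)]
  refine ENNReal.ofReal_le_ofReal ?_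
  nlinarith

theorem IsLDP.ofReal_le_worstCaseFrequencyError (hP : P.IsLDP ε) (hk : 2 ≤ k) (hn : 1 ≤ n)
    (hε : 0 < ε) (hεk : ε ≤ max 1 (1 / 16 * Real.log k)) (h0 : 0 ≤ α) (h1 : α ≤ 1)
    (hα : α ≤ ldpRate k n ε / 16) :
    ENNReal.ofReal (α / 512) ≤ P.worstCaseFrequencyError := by
  refine ofReal_le_of_forall_le_sum_spikeLoss (P := P) (o := (⟨0, by omega⟩ : Fin k)) (α := α)
    (t := fun _ => empiricalFrequency) (by omega) (fun r => ?_) fun v => ?_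
  · by_cases hε1 : ε ≤ 1
    · exact hP.le_sum_spikeLoss_of_le_one hk hn hε hε1 h0 h1 hα
    · have hεk' : ε ≤ 1 / 16 * Real.log k := (le_max_iff.1 hεk).resolve_left hε1
      have hk16 : 16 ≤ k := by
        have hlog := Real.log_le_sub_one_of_pos (by positivity : (0 : ℝ) < k)
        have : (16 : ℝ) ≤ k := by linarith
        exact_mod_cast this
      exact hP.le_sum_spikeLoss_of_le_log hk16 hn hε (by linarith) h0 h1 hα
  · calc ∑ x : Fin n → Fin k, (∏ j, ENNReal.ofReal (spikeWeight _ v α (x j))) *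
          P.expectedLoss x (empiricalFrequency x)
        ≤ ∑ x : Fin n → Fin k, (∏ j, ENNReal.ofReal (spikeWeight _ v α (x j))) *
          P.worstCaseFrequencyError := by
          refine Finset.sum_le_sum fun x _ => mul_le_mul_right ?_ _
          exact le_iSup (fun x => P.expectedLoss x (empiricalFrequency x)) x
      _ = P.worstCaseFrequencyError := by
          rw [← Finset.sum_mul, ← Fintype.piFinset_univ,
            Finset.sum_prod_piFinset _ fun _ y => ENNReal.ofReal (spikeWeight _ v α y)]
          simp only [← ENNReal.ofReal_sum_of_nonneg fun x _ => spikeWeight_nonneg h0 h1 x,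
            sum_spikeWeight]
          simp

end NonInteractiveProtocol

/-! ### Choice of the absolute constants -/

theorem mainTheorem2 :
    (∃ c : ℝ, 0 < c ∧
      ∀ (k n : ℕ) (ε : ℝ), 1 ≤ k → 1 ≤ n → 0 < ε →
      ∀ (Seed : Type*) (Msg : Type*) [MeasurableSpace Seed] [MeasurableSpace Msg]
        (P : NonInteractiveProtocol Seed Msg k n), P.IsLDP ε →
        ENNReal.ofReal (c * min 1 (ldpRate k n ε)) ≤ P.worstCaseDistributionError) ∧
    (∃ c c' : ℝ, 0 < c ∧ 0 < c' ∧
      ∀ (k n : ℕ) (ε : ℝ), 1 ≤ k → 1 ≤ n → 0 < ε → ε ≤ max 1 (c' * Real.log k) →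
      ∀ (Seed : Type*) (Msg : Type*) [MeasurableSpace Seed] [MeasurableSpace Msg]
        (P : NonInteractiveProtocol Seed Msg k n), P.IsLDP ε →
        ENNReal.ofReal (c * min 1 (ldpRate k n ε)) ≤ P.worstCaseFrequencyError) := by
  have h0 : ∀ k n ε, 0 ≤ min 1 (ldpRate k n ε) / 16 := fun k n ε => by
    have := ldpRate_nonneg k n ε
    positivity
  have h1 : ∀ k n ε, min 1 (ldpRate k n ε) / 16 ≤ 1 := fun k n ε => by
    linarith [min_le_left 1 (ldpRate k n ε)]
  have hα : ∀ k n ε, min 1 (ldpRate k n ε) / 16 ≤ ldpRate k n ε / 16 := fun k n ε => by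
    linarith [min_le_right 1 (ldpRate k n ε)]
  -- The factor `16` comes from the choice of `α`; `512 = 64 · 8` combines the threshold `α / 64`
  -- with the failure probability `1/8`.
  have hc : ∀ m : ℝ, 1 / 8192 * m = m / 16 / 512 := fun m => by ring
  have htriv : ∀ k n ε, 1 ≤ k → ¬ 2 ≤ k → ldpRate k n ε = 0 := fun k n ε hk hk2 =>
    ldpRate_eq_zero_of_log_eq_zero (by simp [show k = 1 by omega])
  refine ⟨⟨1 / 8192, by norm_num, fun k n ε hk hn hε Seed Msg _ _ P hP => ?_⟩,
    ⟨1 / 8192, 1 / 16, by norm_num, by norm_num, fun k n ε hk hn hε hεk Seed Msg _ _ P hP => ?_⟩⟩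
  · by_cases hk2 : 2 ≤ k
    · rw [hc]
      exact hP.ofReal_le_worstCaseDistributionError hk2 hn hε (h0 k n ε) (h1 k n ε) (hα k n ε)
    · simp [htriv k n ε hk hk2]
  · by_cases hk2 : 2 ≤ k
    · rw [hc]
      exact hP.ofReal_le_worstCaseFrequencyError hk2 hn hε hεk (h0 k n ε) (h1 k n ε) (hα k n ε)
    · simp [htriv k n ε hk hk2]
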